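/- Let $\mathcal Y$ and $\mathcal Z$ be smooth manifolds of dimensions $a$ and $b$, smoothly embedded in $\mathbb R^n$ and $\mathbb R^p$ respectively, with $a+b=m$, so that $\mathcal Y\times\mathcal Z$ is an $m$-dimensional manifold embedded in $\mathbb R^{n+p}$. Let $\mathrm{Vol}$ be its volume measure, i.e. $m$-dimensional Hausdorff measure, normalised to agree with Lebesgue measure on $\mathbb R^m$. Let $\mathcal O_1,\dots,\mathcal O_l$ be a partition of $\mathbb R^m$ into Borel sets, and let $G:\mathbb R^m\to\mathcal Y\times\mathcal Z$ be a function whose restriction $G_i=G|_{\mathcal O_i}$ to each piece is smooth and invertible: it is $C^\infty$ on $\mathcal O_i$, injective (hence invertible onto its image $G_i(\mathcal O_i)$, which may or may not be all of $\mathcal Y\times\mathcal Z$), and its $(n+p)\times m$ Jacobian matrix $\nabla G_i(x)$ has rank $m$ for Lebesgue-almost every $x\in\mathcal O_i$. Let $X$ be a random point of $\mathbb R^m$ whose law has density $\pi_{\mathbb R^m}$ with respect to Lebesgue measure. Then the law of $G(X)$ has a density with respect to $\mathrm{Vol}$, namely $$\pi_{\mathcal Y\times\mathcal Z}(y,z)=\sum_{\substack{1\le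 i\le l\\ (y,z)\in G_i(\mathcal O_i)}}\frac{\pi_{\mathbb R^m}(x_i)}{\sqrt{\det\bigl(\nabla G_i(x_i)^\top\nabla G_i(x_i)\bigr)}},\qquad x_i=G_i^{-1}(y,z),$$ for $\mathrm{Vol}$-almost every $(y,z)$. If every $G_i$ is a bijection onto $\mathcal Y\times\mathcal Z$, the sum is over all $i=1,\dots,l$. -/

import Mathlib

open MeasureTheory Manifold
open scoped ContDiff

noncomputable section

/-- `EucSp d` is `ℝ^d` with its Euclidean norm. -/
abbrev EucSp (d : ℕ) : Type := EuclideanSpace ℝ (Fin d)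

/-- The random element `X` of `S` (defined on the probability space `(Ω, P)`) has the density `f`
with respect to the reference measure `μ` on `S`. -/
structure HasDensity {Ω S : Type*} [MeasurableSpace Ω] [MeasurableSpace S]
    (P : Measure Ω) (X : Ω → S) (μ : Measure S) (f : S → ℝ) : Prop where
  aemeasurable_var : AEMeasurable X P
  aemeasurable_density : AEMeasurable f μ
  nonneg : ∀ᵐ s ∂μ, 0 ≤ f s
  law_eq : P.map X = μ.withDensity (fun s => ENNReal.ofReal (f s))

/-- Given embeddings `ιY : Y → ℝⁿ` and `ιZ : Z → ℝᵖ`, the inclusion of `Y × Z` in the Euclidean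
space `ℝⁿ⁺ᵖ = ℝⁿ × ℝᵖ`. -/
def prodEmb {Y Z : Type*} {n p : ℕ} (ιY : Y → EucSp n) (ιZ : Z → EucSp p) (q : Y × Z) :
    EuclideanSpace ℝ (Fin n ⊕ Fin p) :=
  WithLp.toLp 2 (Sum.elim (ιY q.1) (ιZ q.2))

/-- The volume measure of `Y × Z` as a `d`-dimensional manifold embedded in `ℝⁿ⁺ᵖ`: the volume of
a set is the `d`-dimensional Hausdorff measure of its image in `ℝⁿ⁺ᵖ`, normalised so as to agree
with Lebesgue measure on `ℝᵈ`. -/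
def prodVolume {Y Z : Type*} [MeasurableSpace Y] [MeasurableSpace Z] {n p : ℕ}
    (ιY : Y → EucSp n) (ιZ : Z → EucSp p) (d : ℕ) : Measure (Y × Z) :=
  (μHE[d] : Measure (EuclideanSpace ℝ (Fin n ⊕ Fin p))).comap (prodEmb ιY ιZ)

/-- The `(n + p) × m` Jacobian matrix `∇(G|O)(x)` of the restriction to `O ⊆ ℝᵐ` of a map
`G : ℝᵐ → Y × Z`, where `Y × Z` is regarded as a subset of `ℝⁿ⁺ᵖ`; the entry `(k, j)` is the `j`-th
partial derivative of the `k`-th coordinate. -/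
def jacobianOn {Y Z : Type*} {m n p : ℕ} (ιY : Y → EucSp n) (ιZ : Z → EucSp p)
    (G : EucSp m → Y × Z) (O : Set (EucSp m)) (x : EucSp m) :
    Matrix (Fin n ⊕ Fin p) (Fin m) ℝ :=
  Matrix.of fun k j =>
    (fderivWithin ℝ (fun t => prodEmb ιY ιZ (G t)) O x (EuclideanSpace.single j 1)) k

/-- The term `π(x) / √det(∇G(x)ᵀ ∇G(x))` at `x = (G|O)⁻¹(q)` contributed by the piece `O`, which is
`0` at the points `q` that `G` does not take on `O`. -/
def pieceDensity {Y Z : Type*} {m n p : ℕ} (ιY : Y → EucSp n) (ιZ : Z → EucSp p)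
    (G : EucSp m → Y × Z) (O : Set (EucSp m)) (π : EucSp m → ℝ) : Y × Z → ℝ :=
  (G '' O).indicator fun q =>
    let x := Function.invFunOn G O q
    π x / √((jacobianOn ιY ιZ G O x).transpose * jacobianOn ιY ιZ G O x).det

end

/-!
The statement is the area formula for an injective differentiable map from `ℝᵐ` into a Euclidean
space, applied to each piece of the partition and summed.

The volume factor `√det(∇Gᵀ∇G)` of the Jacobian matrix is Mathlib's `LinearMap.normDet` of the
derivative, the factor by which an injective linear map multiplies `m`-dimensional Hausdorff
measure. The area formula follows from this linear case by comparison. Where the derivative is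
injective, the domain splits into countably many pieces on which the map is so close to an injective
linear map `A` that each of the two is `C`-Lipschitz with respect to the other, with `C > 1`
arbitrary. A change of metric by at most the factor `C` changes `m`-dimensional measure by at most
`C ^ m` (`euclideanHausdorffMeasure_image_le_of_dist_le`), so the measure of the image of a piece is
that of its image under `A` up to this factor. At almost every point of the piece the derivative is
as close to `A` as the map is (`ApproximatesLinearOn.ae_nnnorm_fderiv_sub_le`), so the same
comparison, made on the unit ball, bounds the ratio of the two volume factors. Summing over the
pieces gives the formula up to the factor `C ^ (2 * m)`
(`euclideanHausdorffMeasure_image_approx`), and `C` tends to `1`.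

The points of a piece `O i` where the Jacobian matrix has smaller rank form a null set, whose image
is null as well (`euclideanHausdorffMeasure_image_eq_zero`), so they affect neither the law of
`G (X)` nor the density up to almost everywhere equality (`withDensity_comap_eq_map`). The manifold
structure enters only in two ways: `G` is differentiable as a map into Euclidean space, and
`Y × Z` is a locally compact second countable space, so that its image in Euclidean space is a
countable union of compact sets and the embedding preserves measurability.
-/

open Module Set
open scoped NNReal ENNReal

/-! ### Derivatives of maps between spaces of different dimensions -/

section Derivative

variable {E F : Type*} [NormedAddCommGroup E] [NormedSpace ℝ E] [FiniteDimensional ℝ E]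
  [MeasurableSpace E] [BorelSpace E] [NormedAddCommGroup F] [NormedSpace ℝ F]

/-- The endomorphism `(v, w) ↦ (0, A v)` of `E × F` attached to a linear map `A : E → F`. -/
noncomputable def shearPart (A : E →L[ℝ] F) : E × F →L[ℝ] E × F :=
  (ContinuousLinearMap.inr ℝ E F).comp (A.comp (ContinuousLinearMap.fst ℝ E F))

omit [FiniteDimensional ℝ E] [MeasurableSpace E] [BorelSpace E] in
theorem shearPart_apply (A : E →L[ℝ] F) (z : E × F) : shearPart A z = (0, A z.1) := rfl

omit [FiniteDimensional ℝ E] [MeasurableSpace E] [BorelSpace E] in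
theorem HasFDerivWithinAt.shearPart {f : E → F} {A : E →L[ℝ] F} {s : Set E} {z : E × F}
    (h : HasFDerivWithinAt f A s z.1) :
    HasFDerivWithinAt (fun z : E × F => ((0 : E), f z.1)) (shearPart A) (s ×ˢ univ) z := by
  have h1 : HasFDerivWithinAt (fun z : E × F => f z.1) (A.comp (ContinuousLinearMap.fst ℝ E F))
      (s ×ˢ univ) z :=
    h.comp z hasFDerivWithinAt_fst fun w hw => hw.1
  exact ((ContinuousLinearMap.inr ℝ E F).hasFDerivAt.comp_hasFDerivWithinAt z h1)

variable [FiniteDimensional ℝ F] {f : E → F} {f' : E → E →L[ℝ] F} {s : Set E}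

/-- If `f` is approximated by the linear map `A` on `s` up to `δ`, then its derivative is within `δ`
of `A` almost everywhere on `s`. Mathlib has this for self-maps; the general case is the case of the
self-map `(x, y) ↦ (0, f x)` of `E × F`. -/
theorem ApproximatesLinearOn.ae_nnnorm_fderiv_sub_le (μ : Measure E) [μ.IsAddHaarMeasure]
    {A : E →L[ℝ] F} {δ : ℝ≥0} (hf : ApproximatesLinearOn f A s δ) (hs : MeasurableSet s)
    (hf' : ∀ x ∈ s, HasFDerivWithinAt f (f' x) s x) : ∀ᵐ x ∂μ.restrict s, ‖f' x - A‖₊ ≤ δ := by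
  borelize F
  let ν : Measure F := Measure.addHaar
  have happ : ApproximatesLinearOn (fun z : E × F => ((0 : E), f z.1)) (shearPart A)
      (s ×ˢ univ) δ := by
    intro z hz w hw
    have h := hf z.1 hz.1 w.1 hw.1
    simp only [shearPart_apply, Prod.mk_sub_mk, sub_zero, Prod.fst_sub, Prod.norm_mk, norm_zero]
    rw [max_eq_right (norm_nonneg _)]
    exact h.trans (by gcongr; exact norm_fst_le (z - w))
  have hae := happ.norm_fderiv_sub_le (μ.prod ν) (hs.prod MeasurableSet.univ)
    (fun z => shearPart (f' z.1)) fun z hz => (hf' z.1 hz.1).shearPart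
  rw [← Measure.prod_restrict, Measure.restrict_univ] at hae
  filter_upwards [Measure.ae_ae_of_ae_prod hae] with x hx
  obtain ⟨y, hy⟩ := hx.exists
  refine ContinuousLinearMap.opNorm_le_bound _ δ.2 fun v => ?_
  have h := (shearPart (f' x) - shearPart A).le_of_opNorm_le (c := δ) (by exact_mod_cast hy) (v, 0)
  simpa [shearPart_apply] using h

/-- The derivative of a map differentiable on a measurable set is almost everywhere measurable
there. -/
theorem aemeasurable_fderivWithin_of_finiteDimensional (μ : Measure E) [μ.IsAddHaarMeasure]
    (hs : MeasurableSet s) (hf' : ∀ x ∈ s, HasFDerivWithinAt f (f' x) s x) :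
    AEMeasurable f' (μ.restrict s) := by
  borelize F
  let ν : Measure F := Measure.addHaar
  have h := aemeasurable_fderivWithin (μ.prod ν) (hs.prod MeasurableSet.univ)
    (f' := fun z => shearPart (f' z.1)) fun z hz => (hf' z.1 hz.1).shearPart
  rw [← Measure.prod_restrict, Measure.restrict_univ] at h
  -- `f' x` is recovered from `(v, w) ↦ (0, f' x v)` by composing with the inclusion and projection
  have hcont : Continuous fun B : E × F →L[ℝ] E × F =>
      (ContinuousLinearMap.snd ℝ E F).comp (B.comp (ContinuousLinearMap.inl ℝ E F)) := by
    fun_prop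
  have h2 := (hcont.measurable.comp_aemeasurable h).aestronglyMeasurable
  have h3 : AEStronglyMeasurable (fun z : E × F => f' z.1) ((μ.restrict s).prod ν) := by
    refine h2.congr (Filter.Eventually.of_forall fun z => ?_)
    ext v
    simp [shearPart_apply]
  exact (AEStronglyMeasurable.of_comp_fst h3 (NeZero.ne ν)).aemeasurable

end Derivative

/-! ### Hausdorff measure and almost isometric maps -/

section Comparison

theorem euclideanHausdorffMeasure_image_le_of_dist_le {X V W : Type*} [MetricSpace V]
    [MeasurableSpace V] [BorelSpace V] [MetricSpace W] [MeasurableSpace W] [BorelSpace W]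
    {f : X → V} {g : X → W} {t : Set X} {C : ℝ≥0}
    (h : ∀ x ∈ t, ∀ y ∈ t, dist (f x) (f y) ≤ C * dist (g x) (g y)) (d : ℕ) :
    (μHE[d] : Measure V) (f '' t) ≤ (C : ℝ≥0∞) ^ d * (μHE[d] : Measure W) (g '' t) := by
  rcases t.eq_empty_or_nonempty with rfl | ⟨x₀, hx₀⟩
  · simp
  have : Nonempty X := ⟨x₀⟩
  -- `f` factors on `t` as a `C`-Lipschitz map composed with `g`
  let k : W → V := fun w => f (Function.invFunOn g t w)
  have hinv : ∀ x ∈ t, Function.invFunOn g t (g x) ∈ t ∧ g (Function.invFunOn g t (g x)) = g x :=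
    fun x hx => ⟨Function.invFunOn_mem ⟨x, hx, rfl⟩, Function.invFunOn_eq ⟨x, hx, rfl⟩⟩
  have hk : ∀ x ∈ t, k (g x) = f x := fun x hx => by
    obtain ⟨h1, h2⟩ := hinv x hx
    have := h _ h1 x hx
    rw [h2, dist_self, mul_zero] at this
    exact dist_le_zero.1 this
  have hlip : LipschitzOnWith C k (g '' t) := by
    refine LipschitzOnWith.of_dist_le_mul ?_
    rintro _ ⟨x, hx, rfl⟩ _ ⟨y, hy, rfl⟩
    rw [hk x hx, hk y hy]
    exact h x hx y hy
  have himg : k '' (g '' t) = f '' t := by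
    rw [image_image]
    exact image_congr hk
  have := hlip.hausdorffMeasure_image_le (d := d) (Nat.cast_nonneg d)
  rw [himg, ENNReal.rpow_natCast] at this
  simp only [Measure.euclideanHausdorffMeasure_def, Measure.smul_apply]
  rw [mul_smul_comm]
  gcongr

variable {U V : Type*} [NormedAddCommGroup U] [InnerProductSpace ℝ U] [FiniteDimensional ℝ U]
  [NormedAddCommGroup V] [InnerProductSpace ℝ V]

/-- For an injective linear map `A`, a vector close enough to `A v` relative to `‖v‖` has the norm of
`A v` up to the factor `C`, since `‖v‖` is bounded by a multiple of `‖A v‖`. -/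
theorem ContinuousLinearMap.exists_forall_norm_le_of_norm_sub_le {C : ℝ≥0} (hC : 1 < C)
    {A : U →L[ℝ] V} (hA : (A : U →ₗ[ℝ] V).ker = ⊥) :
    ∃ δ : ℝ≥0, δ ≠ 0 ∧ ∀ (v : U) (w : V), ‖w - A v‖ ≤ δ * ‖v‖ →
      ‖w‖ ≤ C * ‖A v‖ ∧ ‖A v‖ ≤ C * ‖w‖ := by
  obtain ⟨K, hK, hAK⟩ := (A : U →ₗ[ℝ] V).exists_antilipschitzWith hA
  have hC0 : 0 < C := one_pos.trans hC
  have hC' : (1 : ℝ) < C := by exact_mod_cast hC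
  -- with this choice `C * δ * K = C - 1`
  refine ⟨(C - 1) / (C * K), (div_pos (tsub_pos_of_lt hC) (mul_pos hC0 hK)).ne', fun v w h => ?_⟩
  have hv : ‖v‖ ≤ K * ‖A v‖ := by simpa using hAK.le_mul_dist v 0
  have hδ : C * ((((C - 1) / (C * K) : ℝ≥0) : ℝ) * ‖v‖) ≤ (C - 1) * ‖A v‖ := by
    have hK' : (0 : ℝ) < K := by exact_mod_cast hK
    have hC0' : (0 : ℝ) < C := by exact_mod_cast hC0
    rw [NNReal.coe_div, NNReal.coe_sub hC.le, NNReal.coe_mul, NNReal.coe_one]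
    calc (C : ℝ) * (((C : ℝ) - 1) / (C * K) * ‖v‖) = (C - 1) * (‖v‖ / K) := by field_simp
      _ ≤ (C - 1) * ‖A v‖ := by
        refine mul_le_mul_of_nonneg_left ?_ (by linarith)
        rw [div_le_iff₀ hK', mul_comm]; exact hv
  have h0 : 0 ≤ (((C - 1) / (C * K) : ℝ≥0) : ℝ) * ‖v‖ := by positivity
  have h1 : ‖w‖ ≤ ‖A v‖ + ‖w - A v‖ := norm_le_norm_add_norm_sub' w (A v)
  have h2 : ‖A v‖ ≤ ‖w‖ + ‖w - A v‖ := norm_le_norm_add_norm_sub w (A v)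
  constructor <;> nlinarith [norm_nonneg w, norm_nonneg (A v)]

variable [MeasurableSpace U] [BorelSpace U] [MeasurableSpace V] [BorelSpace V]

theorem LinearMap.ofReal_normDet_le_of_norm_le {A B : U →ₗ[ℝ] V} {C : ℝ≥0}
    (h : ∀ v, ‖B v‖ ≤ C * ‖A v‖) :
    ENNReal.ofReal B.normDet ≤ (C : ℝ≥0∞) ^ finrank ℝ U * ENNReal.ofReal A.normDet := by
  have hle := euclideanHausdorffMeasure_image_le_of_dist_le (f := B) (g := A)
    (t := Metric.ball (0 : U) 1) (C := C)
    (fun x _ y _ => by simpa [dist_eq_norm, ← map_sub] using h (x - y)) (finrank ℝ U)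
  rw [B.euclideanHausdorffMeasure_image_eq_normDet_mul_volume,
    A.euclideanHausdorffMeasure_image_eq_normDet_mul_volume, ← mul_assoc] at hle
  exact (ENNReal.mul_le_mul_iff_left (Metric.measure_ball_pos volume (0 : U) one_pos).ne'
    measure_ball_lt_top.ne).1 hle

omit [MeasurableSpace U] [BorelSpace U] [MeasurableSpace V] [BorelSpace V] in
theorem ContinuousLinearMap.continuous_normDet :
    Continuous fun A : U →L[ℝ] V => (A : U →ₗ[ℝ] V).normDet := by
  have h : (fun A : U →L[ℝ] V => (A : U →ₗ[ℝ] V).normDet) = fun A : U →L[ℝ] V =>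
      √(Matrix.gram ℝ fun i => A (stdOrthonormalBasis ℝ U i)).det := by
    funext A
    have hsq := (A : U →ₗ[ℝ] V).normDet_sq_eq_det_gram (stdOrthonormalBasis ℝ U)
    exact ((congrArg Real.sqrt hsq).symm.trans (Real.sqrt_sq (LinearMap.normDet_nonneg _))).symm
  rw [h]
  refine Real.continuous_sqrt.comp (Continuous.matrix_det ?_)
  refine continuous_matrix fun i j => ?_
  simp only [Matrix.gram_apply]
  fun_prop

end Comparison

/-! ### The area formula for injective maps -/

section AreaFormula

variable {U V : Type*} [NormedAddCommGroup U] [InnerProductSpace ℝ U] [FiniteDimensional ℝ U]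
  [MeasurableSpace U] [BorelSpace U] [NormedAddCommGroup V] [InnerProductSpace ℝ V]
  [FiniteDimensional ℝ V] [MeasurableSpace V] [BorelSpace V]
  {f : U → V} {f' : U → U →L[ℝ] V} {s : Set U}

/-- A differentiable map sends Lebesgue null sets to sets of zero Hausdorff measure of the dimension
of its source. -/
theorem euclideanHausdorffMeasure_image_eq_zero
    (hf' : ∀ x ∈ s, HasFDerivWithinAt f (f' x) s x) (hs : volume s = 0) :
    (μHE[finrank ℝ U] : Measure V) (f '' s) = 0 := by
  obtain ⟨t, A, -, hst, happ, -⟩ :=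
    exists_closed_cover_approximatesLinearOn_of_hasFDerivWithinAt f s f' hf' (fun _ => 1)
      fun _ => one_ne_zero
  have hcover : f '' s ⊆ ⋃ n, f '' (s ∩ t n) := by
    rw [← image_iUnion, ← inter_iUnion]
    exact image_mono (subset_inter Subset.rfl hst)
  refine measure_mono_null hcover (measure_iUnion_null fun n => ?_)
  have hlip : ∀ x ∈ s ∩ t n, ∀ y ∈ s ∩ t n, dist (f x) (f y) ≤ (‖A n‖₊ + 1 : ℝ≥0) * dist x y := by
    intro x hx y hy
    simpa [Subtype.dist_eq] using! (happ n).lipschitz.dist_le_mul ⟨x, hx⟩ ⟨y, hy⟩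
  have hle := euclideanHausdorffMeasure_image_le_of_dist_le (f := f) (g := id) hlip (finrank ℝ U)
  rw [image_id, InnerProductSpace.euclideanHausdorffMeasure_eq_volume,
    measure_mono_null inter_subset_left hs, mul_zero] at hle
  exact nonpos_iff_eq_zero.1 hle

/-- The area formula up to a multiplicative error. On countably many pieces `f` is so close to an
injective linear map `A` that the two are comparable up to the factor `C`; so are then the measures
of the images under `f` and `A`, and the values of `normDet` at `A` and at the derivative of `f`. -/
theorem euclideanHausdorffMeasure_image_approx (hs : MeasurableSet s)
    (hf' : ∀ x ∈ s, HasFDerivWithinAt f (f' x) s x) (hinj : InjOn f s)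
    (hker : ∀ x ∈ s, (f' x : U →ₗ[ℝ] V).ker = ⊥) {C : ℝ≥0} (hC : 1 < C) :
    μHE[finrank ℝ U] (f '' s) ≤ (C : ℝ≥0∞) ^ (2 * finrank ℝ U) *
        ∫⁻ x in s, ENNReal.ofReal (f' x : U →ₗ[ℝ] V).normDet ∧
      ∫⁻ x in s, ENNReal.ofReal (f' x : U →ₗ[ℝ] V).normDet ≤
        (C : ℝ≥0∞) ^ (2 * finrank ℝ U) * μHE[finrank ℝ U] (f '' s) := by
  classical
  rcases s.eq_empty_or_nonempty with rfl | hne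
  · simp
  have hδ : ∀ A : U →L[ℝ] V, ∃ δ : ℝ≥0, δ ≠ 0 ∧ ((A : U →ₗ[ℝ] V).ker = ⊥ →
      ∀ (v : U) (w : V), ‖w - A v‖ ≤ δ * ‖v‖ → ‖w‖ ≤ C * ‖A v‖ ∧ ‖A v‖ ≤ C * ‖w‖) := fun A => by
    by_cases hA : (A : U →ₗ[ℝ] V).ker = ⊥
    · obtain ⟨δ, h0, h⟩ := A.exists_forall_norm_le_of_norm_sub_le hC hA
      exact ⟨δ, h0, fun _ => h⟩
    · exact ⟨1, one_ne_zero, fun h => absurd h hA⟩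
  choose δ hδ0 hδ using hδ
  obtain ⟨t, A, hdisj, hmeas, hcover, happ, hA⟩ :=
    exists_partition_approximatesLinearOn_of_hasFDerivWithinAt f s f' hf' δ hδ0
  have hAker : ∀ n, (A n : U →ₗ[ℝ] V).ker = ⊥ := fun n => by
    obtain ⟨y, hy, h⟩ := hA hne n
    rw [h]
    exact hker y hy
  have hpm : ∀ n, MeasurableSet (s ∩ t n) := fun n => hs.inter (hmeas n)
  have hpdisj : Pairwise (Function.onFun Disjoint fun n => s ∩ t n) := fun i j hij =>
    (hdisj hij).mono inter_subset_right inter_subset_right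
  have hs_eq : s = ⋃ n, s ∩ t n := by
    rw [← inter_iUnion, inter_eq_left.2 hcover]
  have hcont : ContinuousOn f s := fun x hx => (hf' x hx).continuousWithinAt
  -- both sides are sums over the pieces
  have hleft : (μHE[finrank ℝ U] : Measure V) (f '' s) =
      ∑' n, μHE[finrank ℝ U] (f '' (s ∩ t n)) := by
    conv_lhs => rw [hs_eq, image_iUnion]
    refine measure_iUnion (fun i j hij => ?_) fun n =>
      (hpm n).image_of_continuousOn_injOn (hcont.mono inter_subset_left)
        (hinj.mono inter_subset_left)
    rw [Function.onFun, disjoint_iff_inter_eq_empty,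
      ← hinj.image_inter inter_subset_left inter_subset_left, (hpdisj hij).inter_eq, image_empty]
  have hright : ∫⁻ x in s, ENNReal.ofReal (f' x : U →ₗ[ℝ] V).normDet =
      ∑' n, ∫⁻ x in s ∩ t n, ENNReal.ofReal (f' x : U →ₗ[ℝ] V).normDet := by
    conv_lhs => rw [hs_eq]
    exact lintegral_iUnion hpm hpdisj _
  -- the image of a piece under `f` against its image under `A n`
  have hdist : ∀ n, ∀ x ∈ s ∩ t n, ∀ y ∈ s ∩ t n,
      dist (f x) (f y) ≤ C * dist (A n x) (A n y) ∧
        dist (A n x) (A n y) ≤ C * dist (f x) (f y) := fun n x hx y hy => by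
    simp only [dist_eq_norm, ← map_sub]
    exact hδ (A n) (hAker n) (x - y) (f x - f y) (happ n x hx y hy)
  have himage : ∀ n, (μHE[finrank ℝ U] : Measure V) (A n '' (s ∩ t n)) =
      ENNReal.ofReal (A n : U →ₗ[ℝ] V).normDet * volume (s ∩ t n) := fun n =>
    (A n : U →ₗ[ℝ] V).euclideanHausdorffMeasure_image_eq_normDet_mul_volume _
  -- the volume factor of the derivative against that of `A n`
  have hnorm : ∀ n, ∀ᵐ x ∂volume.restrict (s ∩ t n),
      ENNReal.ofReal (f' x : U →ₗ[ℝ] V).normDet ≤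
          (C : ℝ≥0∞) ^ finrank ℝ U * ENNReal.ofReal (A n : U →ₗ[ℝ] V).normDet ∧
        ENNReal.ofReal (A n : U →ₗ[ℝ] V).normDet ≤
          (C : ℝ≥0∞) ^ finrank ℝ U * ENNReal.ofReal (f' x : U →ₗ[ℝ] V).normDet := fun n => by
    filter_upwards [(happ n).ae_nnnorm_fderiv_sub_le volume (hpm n) (f' := f')
      fun x hx => (hf' x hx.1).mono inter_subset_left] with x hx
    have h : ∀ v, ‖f' x v‖ ≤ C * ‖A n v‖ ∧ ‖A n v‖ ≤ C * ‖f' x v‖ := fun v =>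
      hδ (A n) (hAker n) v (f' x v) ((f' x - A n).le_of_opNorm_le (by exact_mod_cast hx) v)
    exact ⟨LinearMap.ofReal_normDet_le_of_norm_le fun v => (h v).1,
      LinearMap.ofReal_normDet_le_of_norm_le fun v => (h v).2⟩
  have hpow : (C : ℝ≥0∞) ^ (2 * finrank ℝ U) = (C : ℝ≥0∞) ^ finrank ℝ U * C ^ finrank ℝ U := by
    rw [two_mul, pow_add]
  have hCtop : (C : ℝ≥0∞) ^ finrank ℝ U ≠ ⊤ := ENNReal.pow_ne_top ENNReal.coe_ne_top
  rw [hleft, hright, ← ENNReal.tsum_mul_left, ← ENNReal.tsum_mul_left, hpow]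
  constructor
  · refine ENNReal.tsum_le_tsum fun n => ?_
    calc (μHE[finrank ℝ U] : Measure V) (f '' (s ∩ t n))
        ≤ C ^ finrank ℝ U * μHE[finrank ℝ U] (A n '' (s ∩ t n)) :=
          euclideanHausdorffMeasure_image_le_of_dist_le
            (fun x hx y hy => (hdist n x hx y hy).1) _
      _ = C ^ finrank ℝ U *
          ∫⁻ _ in s ∩ t n, ENNReal.ofReal (A n : U →ₗ[ℝ] V).normDet := by
          rw [himage, setLIntegral_const]
      _ ≤ C ^ finrank ℝ U * ∫⁻ x in s ∩ t n,
          C ^ finrank ℝ U * ENNReal.ofReal (f' x : U →ₗ[ℝ] V).normDet := by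
          gcongr 1
          exact lintegral_mono_ae ((hnorm n).mono fun x hx => hx.2)
      _ = _ := by rw [lintegral_const_mul' _ _ hCtop, mul_assoc]
  · refine ENNReal.tsum_le_tsum fun n => ?_
    calc ∫⁻ x in s ∩ t n, ENNReal.ofReal (f' x : U →ₗ[ℝ] V).normDet
        ≤ ∫⁻ _ in s ∩ t n, C ^ finrank ℝ U * ENNReal.ofReal (A n : U →ₗ[ℝ] V).normDet :=
          lintegral_mono_ae ((hnorm n).mono fun x hx => hx.1)
      _ = C ^ finrank ℝ U * μHE[finrank ℝ U] (A n '' (s ∩ t n)) := by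
          rw [setLIntegral_const, himage, mul_assoc]
      _ ≤ C ^ finrank ℝ U * (C ^ finrank ℝ U * μHE[finrank ℝ U] (f '' (s ∩ t n))) := by
          gcongr
          exact euclideanHausdorffMeasure_image_le_of_dist_le
            (fun x hx y hy => (hdist n x hx y hy).2) _
      _ = _ := by rw [mul_assoc]

/-- The area formula for an injective map whose derivative is injective. -/
theorem euclideanHausdorffMeasure_image_eq_lintegral_normDet (hs : MeasurableSet s)
    (hf' : ∀ x ∈ s, HasFDerivWithinAt f (f' x) s x) (hinj : InjOn f s)
    (hker : ∀ x ∈ s, (f' x : U →ₗ[ℝ] V).ker = ⊥) :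
    μHE[finrank ℝ U] (f '' s) = ∫⁻ x in s, ENNReal.ofReal (f' x : U →ₗ[ℝ] V).normDet := by
  have key : ∀ a b : ℝ≥0∞,
      (∀ C : ℝ≥0, 1 < C → a ≤ (C : ℝ≥0∞) ^ (2 * finrank ℝ U) * b) → a ≤ b := by
    intro a b h
    have hlim : Filter.Tendsto (fun C : ℝ≥0 => (C : ℝ≥0∞) ^ (2 * finrank ℝ U) * b)
        (nhdsWithin 1 (Ioi 1)) (nhds (((1 : ℝ≥0) : ℝ≥0∞) ^ (2 * finrank ℝ U) * b)) := by
      refine ENNReal.Tendsto.mul_const (ENNReal.Tendsto.pow ?_) (Or.inl (by simp))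
      exact (ENNReal.continuous_coe.tendsto 1).mono_left nhdsWithin_le_nhds
    simpa using ge_of_tendsto hlim (Filter.eventually_of_mem self_mem_nhdsWithin h)
  exact le_antisymm
    (key _ _ fun C hC => (euclideanHausdorffMeasure_image_approx hs hf' hinj hker hC).1)
    (key _ _ fun C hC => (euclideanHausdorffMeasure_image_approx hs hf' hinj hker hC).2)

end AreaFormula

/-! ### Change of variables for the volume of an embedded space -/

section ChangeOfVariables

variable {U V T : Type*} [NormedAddCommGroup U] [InnerProductSpace ℝ U] [FiniteDimensional ℝ U]
  [MeasurableSpace U] [BorelSpace U] [NormedAddCommGroup V] [InnerProductSpace ℝ V]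
  [FiniteDimensional ℝ V] [MeasurableSpace V] [BorelSpace V] [MeasurableSpace T]
  {ψ : T → V} {G : U → T} {f' : U → U →L[ℝ] V} {s : Set U}

omit [MeasurableSpace U] [BorelSpace U] [FiniteDimensional ℝ U] [FiniteDimensional ℝ V]
  [MeasurableSpace V] [BorelSpace V] in
theorem continuousOn_of_forall_hasFDerivWithinAt {f : U → V}
    (hf' : ∀ x ∈ s, HasFDerivWithinAt f (f' x) s x) : ContinuousOn f s :=
  fun x hx => (hf' x hx).continuousWithinAt

omit [FiniteDimensional ℝ V] in
theorem measurableEmbedding_domRestrict_of_comp (hψ : MeasurableEmbedding ψ) (hs : MeasurableSet s)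
    (hf' : ∀ x ∈ s, HasFDerivWithinAt (fun t => ψ (G t)) (f' x) s x) (hinj : InjOn G s) :
    MeasurableEmbedding (s.domRestrict G) := by
  have h : MeasurableEmbedding (s.domRestrict fun t => ψ (G t)) :=
    (continuousOn_of_forall_hasFDerivWithinAt hf').measurableEmbedding hs
      fun x hx y hy hxy => hinj hx hy (hψ.injective hxy)
  refine ⟨injOn_iff_injective.1 hinj, hψ.measurable_comp_iff.1 h.measurable, fun {t} ht => ?_⟩
  have himg : ψ ⁻¹' ((s.domRestrict fun t => ψ (G t)) '' t) = s.domRestrict G '' t := by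
    rw [show (s.domRestrict fun t => ψ (G t)) = ψ ∘ s.domRestrict G from rfl, image_comp,
      hψ.injective.preimage_image]
  exact himg ▸ hψ.measurable (h.measurableSet_image' ht)

omit [FiniteDimensional ℝ U] [FiniteDimensional ℝ V] in
theorem aemeasurable_restrict_of_comp (hψ : MeasurableEmbedding ψ) (hs : MeasurableSet s)
    (hf' : ∀ x ∈ s, HasFDerivWithinAt (fun t => ψ (G t)) (f' x) s x) (μ : Measure U) :
    AEMeasurable G (μ.restrict s) :=
  aemeasurable_restrict_of_measurable_subtype hs <| hψ.measurable_comp_iff.1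
    (continuousOn_iff_continuous_domRestrict.1
      (continuousOn_of_forall_hasFDerivWithinAt hf')).measurable

omit [MeasurableSpace V] [BorelSpace V] in
theorem aemeasurable_normDet_fderivWithin {f : U → V} (hs : MeasurableSet s)
    (hf' : ∀ x ∈ s, HasFDerivWithinAt f (f' x) s x) :
    AEMeasurable (fun x => (f' x : U →ₗ[ℝ] V).normDet) (volume.restrict s) :=
  ContinuousLinearMap.continuous_normDet.measurable.comp_aemeasurable
    (aemeasurable_fderivWithin_of_finiteDimensional volume hs hf')

/-- The set version of the area formula, in terms of the pushforward of the measure with density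
`normDet`. -/
theorem map_comap_withDensity_normDet (hψ : MeasurableEmbedding ψ) (hs : MeasurableSet s)
    (hf' : ∀ x ∈ s, HasFDerivWithinAt (fun t => ψ (G t)) (f' x) s x) (hinj : InjOn G s)
    (hker : ∀ x ∈ s, (f' x : U →ₗ[ℝ] V).ker = ⊥) :
    ((volume.withDensity fun x => ENNReal.ofReal (f' x : U →ₗ[ℝ] V).normDet).comap
      ((↑) : s → U)).map (s.domRestrict G) =
        ((μHE[finrank ℝ U] : Measure V).comap ψ).restrict (G '' s) := by
  have hq := measurableEmbedding_domRestrict_of_comp hψ hs hf' hinj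
  ext A hA
  have hpre : MeasurableSet (((↑) : s → U) '' (s.domRestrict G ⁻¹' A)) :=
    (MeasurableEmbedding.subtype_coe hs).measurableSet_image' (hq.measurable hA)
  have hsub : ((↑) : s → U) '' (s.domRestrict G ⁻¹' A) ⊆ s := by
    rintro _ ⟨x, -, rfl⟩
    exact x.2
  have himg : ψ '' (A ∩ G '' s) =
      (fun t => ψ (G t)) '' (((↑) : s → U) '' (s.domRestrict G ⁻¹' A)) := by
    ext v
    constructor
    · rintro ⟨_, ⟨hA, x, hx, rfl⟩, rfl⟩
      exact ⟨x, ⟨⟨x, hx⟩, hA, rfl⟩, rfl⟩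
    · rintro ⟨_, ⟨x, hA, rfl⟩, rfl⟩
      exact ⟨G x, ⟨hA, x, x.2, rfl⟩, rfl⟩
  rw [Measure.map_apply hq.measurable hA, (MeasurableEmbedding.subtype_coe hs).comap_apply,
    withDensity_apply _ hpre, Measure.restrict_apply hA, hψ.comap_apply, himg]
  refine (euclideanHausdorffMeasure_image_eq_lintegral_normDet hpre
    (fun x hx => (hf' x (hsub hx)).mono hsub) ?_ fun x hx => hker x (hsub hx)).symm
  exact fun x hx y hy hxy => hinj (hsub hx) (hsub hy) (hψ.injective hxy)

theorem aemeasurable_restrict_image (hψ : MeasurableEmbedding ψ) (hs : MeasurableSet s)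
    (hf' : ∀ x ∈ s, HasFDerivWithinAt (fun t => ψ (G t)) (f' x) s x) (hinj : InjOn G s)
    (hker : ∀ x ∈ s, (f' x : U →ₗ[ℝ] V).ker = ⊥) {h : T → ℝ}
    (hh : AEMeasurable (fun x => h (G x)) (volume.restrict s)) :
    AEMeasurable h (((μHE[finrank ℝ U] : Measure V).comap ψ).restrict (G '' s)) := by
  rw [← map_comap_withDensity_normDet hψ hs hf' hinj hker,
    (measurableEmbedding_domRestrict_of_comp hψ hs hf' hinj).aemeasurable_map_iff]
  refine (aemeasurable_restrict_iff_comap_subtype hs (f := fun x => h (G x))).1 ?_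
  rw [restrict_withDensity hs]
  exact hh.mono_ac (withDensity_absolutelyContinuous _ _)

/-- The area formula as a change of variables in integrals. -/
theorem lintegral_image_eq_lintegral_normDet_mul (hψ : MeasurableEmbedding ψ)
    (hs : MeasurableSet s)
    (hf' : ∀ x ∈ s, HasFDerivWithinAt (fun t => ψ (G t)) (f' x) s x) (hinj : InjOn G s)
    (hker : ∀ x ∈ s, (f' x : U →ₗ[ℝ] V).ker = ⊥) (h : T → ℝ≥0∞) :
    ∫⁻ q in G '' s, h q ∂(μHE[finrank ℝ U] : Measure V).comap ψ =
      ∫⁻ x in s, ENNReal.ofReal (f' x : U →ₗ[ℝ] V).normDet * h (G x) := by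
  rw [← map_comap_withDensity_normDet hψ hs hf' hinj hker,
    (measurableEmbedding_domRestrict_of_comp hψ hs hf' hinj).lintegral_map]
  simp only [Set.domRestrict_apply, ← Function.comp_apply (f := h)]
  rw [← (MeasurableEmbedding.subtype_coe hs).lintegral_map, map_comap_subtype_coe hs,
    setLIntegral_withDensity_eq_setLIntegral_mul_non_measurable₀ _ _ _ hs]
  · simp only [Pi.mul_apply]
  · simp only [Filter.eventually_true, ENNReal.ofReal_lt_top]
  · exact (aemeasurable_normDet_fderivWithin hs hf').ennreal_ofReal

/-- The pushforward under `G` of a measure with density `π` on `s` has the density `h` on `G '' s`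
if `h (G x)` is `π x` divided by the volume factor of `G` at `x`. -/
theorem withDensity_restrict_image (hψ : MeasurableEmbedding ψ) (hs : MeasurableSet s)
    (hf' : ∀ x ∈ s, HasFDerivWithinAt (fun t => ψ (G t)) (f' x) s x) (hinj : InjOn G s)
    (hker : ∀ x ∈ s, (f' x : U →ₗ[ℝ] V).ker = ⊥) {h : T → ℝ} {π : U → ℝ}
    (hh : ∀ x ∈ s, h (G x) = π x / (f' x : U →ₗ[ℝ] V).normDet) :
    (((μHE[finrank ℝ U] : Measure V).comap ψ).restrict (G '' s)).withDensity
        (fun q => ENNReal.ofReal (h q)) =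
      ((volume.restrict s).withDensity fun x => ENNReal.ofReal (π x)).map G := by
  have hq := measurableEmbedding_domRestrict_of_comp hψ hs hf' hinj
  have hG : AEMeasurable G ((volume.restrict s).withDensity fun x => ENNReal.ofReal (π x)) :=
    (aemeasurable_restrict_of_comp hψ hs hf' volume).mono_ac (withDensity_absolutelyContinuous _ _)
  ext A hA
  have hpre : MeasurableSet (s ∩ G ⁻¹' A) := by
    have h1 := (MeasurableEmbedding.subtype_coe hs).measurableSet_image' (hq.measurable hA)
    rwa [show s.domRestrict G ⁻¹' A = ((↑) : s → U) ⁻¹' (G ⁻¹' A) from rfl,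
      Subtype.image_preimage_coe] at h1
  have hnull : NullMeasurableSet (G ⁻¹' A) (volume.restrict s) :=
    (aemeasurable_restrict_of_comp hψ hs hf' volume).nullMeasurableSet_preimage hA
  rw [withDensity_apply _ hA, Measure.restrict_restrict hA, ← image_preimage_inter,
    inter_comm, lintegral_image_eq_lintegral_normDet_mul hψ hpre
      (fun x hx => (hf' x hx.1).mono inter_subset_left) (hinj.mono inter_subset_left)
      (fun x hx => hker x hx.1), Measure.map_apply_of_aemeasurable hG hA,
    withDensity_apply₀ _ hnull, Measure.restrict_restrict₀ hnull, inter_comm (G ⁻¹' A)]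
  refine setLIntegral_congr_fun hpre fun x hx => ?_
  have hne : (f' x : U →ₗ[ℝ] V).normDet ≠ 0 :=
    fun h0 => LinearMap.normDet_eq_zero_iff_ker_ne_bot.1 h0 (hker x hx.1)
  rw [hh x hx.1, ← ENNReal.ofReal_mul (LinearMap.normDet_nonneg _), mul_div_cancel₀ _ hne]

/-- The density of the image of a random point of `s` under a map that is injective on `s` with
almost everywhere injective derivative. -/
theorem withDensity_comap_eq_map (hψ : MeasurableEmbedding ψ) (hs : MeasurableSet s)
    (hf' : ∀ x ∈ s, HasFDerivWithinAt (fun t => ψ (G t)) (f' x) s x) (hinj : InjOn G s)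
    (hker : ∀ᵐ x, x ∈ s → (f' x : U →ₗ[ℝ] V).ker = ⊥) {h : T → ℝ} {π : U → ℝ}
    (hπ : AEMeasurable π) (hπ0 : ∀ᵐ x, 0 ≤ π x)
    (hh : ∀ x ∈ s, h (G x) = π x / (f' x : U →ₗ[ℝ] V).normDet)
    (hh0 : ∀ q ∉ G '' s, h q = 0) :
    AEMeasurable h ((μHE[finrank ℝ U] : Measure V).comap ψ) ∧
      (∀ᵐ q ∂(μHE[finrank ℝ U] : Measure V).comap ψ, 0 ≤ h q) ∧
      ((μHE[finrank ℝ U] : Measure V).comap ψ).withDensity (fun q => ENNReal.ofReal (h q)) =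
        ((volume.restrict s).withDensity fun x => ENNReal.ofReal (π x)).map G := by
  -- discard a null set outside of which the derivative is injective and `π` is nonnegative
  obtain ⟨N, hN, hNmeas, hN0⟩ := exists_measurable_superset_of_null (ae_iff.1 (hker.and hπ0))
  have hgood : ∀ x ∉ N, (x ∈ s → (f' x : U →ₗ[ℝ] V).ker = ⊥) ∧ 0 ≤ π x := fun x hx =>
    not_not.1 fun h => hx (hN h)
  set ν := (μHE[finrank ℝ U] : Measure V).comap ψ with hν
  have hr : MeasurableSet (s \ N) := hs.diff hNmeas
  have hf'r : ∀ x ∈ s \ N, HasFDerivWithinAt (fun t => ψ (G t)) (f' x) (s \ N) x :=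
    fun x hx => (hf' x hx.1).mono sdiff_subset
  have hinjr : InjOn G (s \ N) := hinj.mono sdiff_subset
  have hkerr : ∀ x ∈ s \ N, (f' x : U →ₗ[ℝ] V).ker = ⊥ := fun x hx => (hgood x hx.2).1 hx.1
  have himg : MeasurableSet (G '' (s \ N)) := by
    have h1 := (measurableEmbedding_domRestrict_of_comp hψ hr hf'r hinjr).measurableSet_range
    rwa [range_domRestrict] at h1
  have hnull : ν (G '' (s ∩ N)) = 0 := by
    rw [hν, hψ.comap_apply, image_image]
    exact euclideanHausdorffMeasure_image_eq_zero
      (fun x hx => (hf' x hx.1).mono inter_subset_left) (measure_mono_null inter_subset_right hN0)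
  have hae : (G '' (s \ N)).indicator h =ᵐ[ν] h := by
    filter_upwards [measure_eq_zero_iff_ae_notMem.1 hnull] with q hq
    by_cases hq1 : q ∈ G '' (s \ N)
    · exact indicator_of_mem hq1 h
    · rw [indicator_of_notMem hq1, hh0]
      rintro ⟨x, hx, rfl⟩
      by_cases hxN : x ∈ N
      · exact hq ⟨x, ⟨hx, hxN⟩, rfl⟩
      · exact hq1 ⟨x, ⟨hx, hxN⟩, rfl⟩
  refine ⟨?_, ?_, ?_⟩
  · refine AEMeasurable.congr ((aemeasurable_indicator_iff himg).2 ?_) hae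
    refine aemeasurable_restrict_image hψ hr hf'r hinjr hkerr ?_
    refine AEMeasurable.congr
      (hπ.restrict.div (aemeasurable_normDet_fderivWithin hr hf'r)) ?_
    filter_upwards [ae_restrict_mem hr] with x hx
    exact (hh x hx.1).symm
  · filter_upwards [hae] with q hq
    rw [← hq]
    refine indicator_nonneg ?_ q
    rintro _ ⟨x, hx, rfl⟩
    rw [hh x hx.1]
    exact div_nonneg (hgood x hx.2).2 (LinearMap.normDet_nonneg _)
  · have hind : (fun q => ENNReal.ofReal (h q)) =ᵐ[ν]
        (G '' (s \ N)).indicator fun q => ENNReal.ofReal (h q) := by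
      filter_upwards [hae] with q hq
      by_cases hq1 : q ∈ G '' (s \ N)
      · rw [indicator_of_mem hq1]
      · rw [indicator_of_notMem hq1] at hq ⊢
        rw [← hq, ENNReal.ofReal_zero]
    rw [withDensity_congr_ae hind, withDensity_indicator himg,
      withDensity_restrict_image hψ hr hf'r hinjr hkerr fun x hx => hh x hx.1,
      Measure.restrict_congr_set (s := s \ N) (t := s)
        (sdiff_ae_eq_self.2 (measure_mono_null inter_subset_right hN0))]

end ChangeOfVariables

/-! ### The embedded product and its Jacobian matrix -/

section Product

variable {Y Z : Type*} {m n p : ℕ} {ιY : Y → EucSp n} {ιZ : Z → EucSp p}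

theorem prodEmb_isEmbedding [TopologicalSpace Y] [TopologicalSpace Z]
    (hY : Topology.IsEmbedding ιY) (hZ : Topology.IsEmbedding ιZ) :
    Topology.IsEmbedding (prodEmb ιY ιZ) := by
  have hcont : Continuous (prodEmb ιY ιZ) := by
    refine (PiLp.continuous_toLp 2 _).comp (continuous_pi fun k => ?_)
    rcases k with k | k
    · exact (EuclideanSpace.proj (𝕜 := ℝ) k).continuous.comp (hY.continuous.comp continuous_fst)
    · exact (EuclideanSpace.proj (𝕜 := ℝ) k).continuous.comp (hZ.continuous.comp continuous_snd)
  -- composed with the two coordinate projections, `prodEmb` is the product embedding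
  let ρ : EuclideanSpace ℝ (Fin n ⊕ Fin p) → EucSp n × EucSp p := fun v =>
    (WithLp.toLp 2 fun k => v (Sum.inl k), WithLp.toLp 2 fun k => v (Sum.inr k))
  have hρ : Continuous ρ := by
    refine ((PiLp.continuous_toLp 2 _).comp (continuous_pi fun k => ?_)).prodMk
      ((PiLp.continuous_toLp 2 _).comp (continuous_pi fun k => ?_))
    · exact (EuclideanSpace.proj (𝕜 := ℝ) (Sum.inl k)).continuous
    · exact (EuclideanSpace.proj (𝕜 := ℝ) (Sum.inr k)).continuous
  exact Topology.IsEmbedding.of_comp hcont hρ (hY.prodMap hZ)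

/-- The image of a locally compact second countable space is a countable union of compact sets. -/
theorem measurableEmbedding_of_isEmbedding_of_locallyCompact {X W : Type*} [TopologicalSpace X]
    [LocallyCompactSpace X] [MeasurableSpace X] [BorelSpace X] [TopologicalSpace W] [T2Space W]
    [SecondCountableTopology W] [MeasurableSpace W] [BorelSpace W] {g : X → W}
    (hg : Topology.IsEmbedding g) : MeasurableEmbedding g := by
  have : SecondCountableTopology X := hg.isInducing.secondCountableTopology
  refine hg.measurableEmbedding ?_
  obtain ⟨K, hK, hKeq⟩ := isSigmaCompact_range hg.continuous
  rw [← hKeq]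
  exact MeasurableSet.iUnion fun n => (hK n).measurableSet

theorem differentiableOn_prodEmb_comp {G : EucSp m → Y × Z} {O : Set (EucSp m)}
    (h1 : DifferentiableOn ℝ (fun x => ιY (G x).1) O)
    (h2 : DifferentiableOn ℝ (fun x => ιZ (G x).2) O) :
    DifferentiableOn ℝ (fun x => prodEmb ιY ιZ (G x)) O := by
  rw [differentiableOn_euclidean]
  rintro (k | k)
  · exact differentiableOn_euclidean.1 h1 k
  · exact differentiableOn_euclidean.1 h2 k

theorem jacobianOn_mulVec (G : EucSp m → Y × Z) (O : Set (EucSp m)) (x v : EucSp m) :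
    (jacobianOn ιY ιZ G O x).mulVec v =
      fderivWithin ℝ (fun t => prodEmb ιY ιZ (G t)) O x v := by
  funext k
  conv_rhs => rw [← (EuclideanSpace.basisFun (Fin m) ℝ).sum_repr v, map_sum]
  simp [jacobianOn, Matrix.mulVec, dotProduct, mul_comm]

theorem ker_fderivWithin_eq_bot_of_rank_jacobianOn {G : EucSp m → Y × Z} {O : Set (EucSp m)}
    {x : EucSp m} (h : (jacobianOn ιY ιZ G O x).rank = m) :
    (fderivWithin ℝ (fun t => prodEmb ιY ιZ (G t)) O x :
      EucSp m →ₗ[ℝ] EuclideanSpace ℝ (Fin n ⊕ Fin p)).ker = ⊥ := by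
  have hnull := (jacobianOn ιY ιZ G O x).mulVecLin.finrank_range_add_finrank_ker
  rw [show finrank ℝ (jacobianOn ιY ιZ G O x).mulVecLin.range = m from h,
    finrank_fin_fun, Nat.add_eq_left, Submodule.finrank_eq_zero] at hnull
  refine LinearMap.ker_eq_bot'.2 fun v hv => ?_
  have hmul : (jacobianOn ιY ιZ G O x).mulVecLin v = 0 := by
    rw [Matrix.mulVecLin_apply, jacobianOn_mulVec]
    simpa using! hv
  have := LinearMap.ker_eq_bot'.1 hnull _ hmul
  ext k
  exact congrFun this k

theorem sqrt_det_jacobianOn (G : EucSp m → Y × Z) (O : Set (EucSp m)) (x : EucSp m) :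
    √((jacobianOn ιY ιZ G O x).transpose * jacobianOn ιY ιZ G O x).det =
      (fderivWithin ℝ (fun t => prodEmb ιY ιZ (G t)) O x :
        EucSp m →ₗ[ℝ] EuclideanSpace ℝ (Fin n ⊕ Fin p)).normDet := by
  set A := fderivWithin ℝ (fun t => prodEmb ιY ιZ (G t)) O x with hA
  have hgram : (jacobianOn ιY ιZ G O x).transpose * jacobianOn ιY ιZ G O x =
      Matrix.gram ℝ fun i => A (EuclideanSpace.basisFun (Fin m) ℝ i) := by
    ext i j
    simp [jacobianOn, Matrix.mul_apply, Matrix.gram_apply, PiLp.inner_apply, hA, mul_comm]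
  have hsq := (A : EucSp m →ₗ[ℝ] EuclideanSpace ℝ (Fin n ⊕ Fin p)).normDet_sq_eq_det_gram
    (EuclideanSpace.basisFun (Fin m) ℝ)
  rw [hgram]
  exact (congrArg Real.sqrt hsq).symm.trans (Real.sqrt_sq (LinearMap.normDet_nonneg _))

theorem pieceDensity_apply {G : EucSp m → Y × Z} {O : Set (EucSp m)} (hinj : InjOn G O)
    (π : EucSp m → ℝ) {x : EucSp m} (hx : x ∈ O) :
    pieceDensity ιY ιZ G O π (G x) =
      π x / (fderivWithin ℝ (fun t => prodEmb ιY ιZ (G t)) O x :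
        EucSp m →ₗ[ℝ] EuclideanSpace ℝ (Fin n ⊕ Fin p)).normDet := by
  rw [pieceDensity, indicator_of_mem (mem_image_of_mem G hx), ← sqrt_det_jacobianOn]
  simp only [hinj.leftInvOn_invFunOn hx]

end Product

/-! ### The density of the image of a random point -/

theorem mainTheorem2
    {m n p a b l : ℕ}
    -- the manifolds `Y` and `Z`, embedded in `ℝⁿ` and `ℝᵖ`, with `dim (Y × Z) = m`
    {Y : Type*} [TopologicalSpace Y] [ChartedSpace (EucSp a) Y] [IsManifold (𝓡 a) ∞ Y]
    [MeasurableSpace Y] [BorelSpace Y]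
    {Z : Type*} [TopologicalSpace Z] [ChartedSpace (EucSp b) Z] [IsManifold (𝓡 b) ∞ Z]
    [MeasurableSpace Z] [BorelSpace Z]
    (ιY : Y → EucSp n) (hιY : IsSmoothEmbedding (𝓡 a) (𝓡 n) ∞ ιY)
    (ιZ : Z → EucSp p) (hιZ : IsSmoothEmbedding (𝓡 b) (𝓡 p) ∞ ιZ)
    (hdim : a + b = m)
    -- the partition of `ℝᵐ`
    (O : Fin l → Set (EucSp m)) (hOmeas : ∀ i, MeasurableSet (O i))
    (hOdisj : Pairwise fun i j => Disjoint (O i) (O j)) (hOcover : (⋃ i, O i) = Set.univ)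
    -- `G` restricts to a smooth and invertible map with Jacobian of full rank on each piece
    (G : EucSp m → Y × Z)
    (hsmooth : ∀ i, ContMDiffOn (𝓡 m) ((𝓡 a).prod (𝓡 b)) ∞ G (O i))
    (hinj : ∀ i, Set.InjOn G (O i))
    (hrank : ∀ i, ∀ᵐ x, x ∈ O i → (jacobianOn ιY ιZ G (O i) x).rank = m)
    -- a random point `X` of `ℝᵐ` with density `π`
    {Ω : Type*} [MeasurableSpace Ω] (P : Measure Ω) [IsProbabilityMeasure P]
    (X : Ω → EucSp m) (π : EucSp m → ℝ) (hX : HasDensity P X volume π) :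
    HasDensity P (fun s => G (X s)) (prodVolume ιY ιZ m)
      (fun q => ∑ i, pieceDensity ιY ιZ G (O i) π q) := by
  have : LocallyCompactSpace Y := ChartedSpace.locallyCompactSpace (EucSp a) Y
  have : LocallyCompactSpace Z := ChartedSpace.locallyCompactSpace (EucSp b) Z
  have : SecondCountableTopology Y := hιY.isEmbedding.isInducing.secondCountableTopology
  have : SecondCountableTopology Z := hιZ.isEmbedding.isInducing.secondCountableTopology
  have hψ : MeasurableEmbedding (prodEmb ιY ιZ) :=
    measurableEmbedding_of_isEmbedding_of_locallyCompact
      (prodEmb_isEmbedding hιY.isEmbedding hιZ.isEmbedding)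
  have hderiv : ∀ i, ∀ x ∈ O i, HasFDerivWithinAt (fun t => prodEmb ιY ιZ (G t))
      (fderivWithin ℝ (fun t => prodEmb ιY ιZ (G t)) (O i) x) (O i) x := fun i x hx => by
    have hY := (hιY.contMDiff.comp_contMDiffOn
      (contMDiff_fst.comp_contMDiffOn (hsmooth i))).contDiffOn
    have hZ := (hιZ.contMDiff.comp_contMDiffOn
      (contMDiff_snd.comp_contMDiffOn (hsmooth i))).contDiffOn
    exact (differentiableOn_prodEmb_comp (hY.differentiableOn (by simp))
      (hZ.differentiableOn (by simp)) x hx).hasFDerivWithinAt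
  have hvol : prodVolume ιY ιZ m =
      (μHE[finrank ℝ (EucSp m)] : Measure _).comap (prodEmb ιY ιZ) := by
    rw [finrank_euclideanSpace_fin]
    rfl
  have hpiece := fun i => withDensity_comap_eq_map hψ (hOmeas i) (hderiv i) (hinj i)
    ((hrank i).mono fun x hx hxO => ker_fderivWithin_eq_bot_of_rank_jacobianOn (hx hxO))
    hX.aemeasurable_density hX.nonneg (h := pieceDensity ιY ιZ G (O i) π)
    (fun x hx => pieceDensity_apply (hinj i) π hx) fun q hq => indicator_of_notMem hq _
  rw [← hvol] at hpiece
  have hsum : (volume : Measure (EucSp m)) = Measure.sum fun i => volume.restrict (O i) := by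
    rw [← Measure.restrict_iUnion hOdisj hOmeas, hOcover, Measure.restrict_univ]
  have hGvol : AEMeasurable G (volume : Measure (EucSp m)) := by
    rw [hsum, aemeasurable_sum_measure_iff]
    exact fun i => aemeasurable_restrict_of_comp hψ (hOmeas i) (hderiv i) volume
  have hGlaw : AEMeasurable G (P.map X) := by
    rw [hX.law_eq]
    exact hGvol.mono_ac (withDensity_absolutelyContinuous _ _)
  have hnonneg : ∀ᵐ q ∂prodVolume ιY ιZ m, ∀ i, 0 ≤ pieceDensity ιY ιZ G (O i) π q :=
    ae_all_iff.2 fun i => (hpiece i).2.1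
  refine ⟨hGlaw.comp_aemeasurable hX.aemeasurable_var,
    Finset.aemeasurable_fun_sum _ fun i _ => (hpiece i).1,
    hnonneg.mono fun q hq => Finset.sum_nonneg fun i _ => hq i, ?_⟩
  calc P.map (fun s => G (X s))
      = (P.map X).map G :=
        (AEMeasurable.map_map_of_aemeasurable hGlaw hX.aemeasurable_var).symm
    _ = ((Measure.sum fun i => volume.restrict (O i)).withDensity
          fun x => ENNReal.ofReal (π x)).map G := by rw [hX.law_eq, ← hsum]
    _ = Measure.sum fun i =>
          ((volume.restrict (O i)).withDensity fun x => ENNReal.ofReal (π x)).map G := by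
        rw [withDensity_sum, Measure.map_sum]
        rw [← withDensity_sum, ← hsum]
        exact hGvol.mono_ac (withDensity_absolutelyContinuous _ _)
    _ = Measure.sum fun i => (prodVolume ιY ιZ m).withDensity
          fun q => ENNReal.ofReal (pieceDensity ιY ιZ G (O i) π q) := by
        simp only [(hpiece _).2.2]
    _ = (prodVolume ιY ιZ m).withDensity
          fun q => ENNReal.ofReal (∑ i, pieceDensity ιY ιZ G (O i) π q) := by
        ext A hA
        rw [Measure.sum_apply _ hA, withDensity_apply _ hA, tsum_fintype]
        simp only [withDensity_apply _ hA]
        rw [← lintegral_finsetSum' _ fun i _ => (hpiece i).1.ennreal_ofReal.restrict]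
        refine lintegral_congr_ae (ae_restrict_of_ae (hnonneg.mono fun q hq => ?_))
        exact (ENNReal.ofReal_sum_of_nonneg fun i _ => hq i).symm
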